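/- Let $q$ be a prime power, $\mathbb F=\mathbb F_q$ and $n=q-1$. Definitions. A convolutional code $\mathcal C\subseteq\mathbb F[z]^n$ with parameters $(n,k,\delta)_q$ is a submodule $\mathcal C=\operatorname{im}G=\{uG\mid u\in\mathbb F[z]^k\}$, where $G\in\mathbb F[z]^{k\times n}$ is a right-invertible matrix and $\delta$ is the maximum degree of the $k\times k$ minors of $G$. A matrix $G\in\mathbb F[z]^{k\times n}$ of rank $k$ is called minimal if the maximum degree of its $k\times k$ minors equals the sum of its row degrees, where the degree of a row is the maximum degree of its entries. The memory of $\mathcal C$ is the largest row degree of a minimal matrix $G$ with $\mathcal C=\operatorname{im}G$ (it does not depend on the choice of $G$). The weight of $v=\sum_{j=0}^N v_jz^j\in\mathbb F[z]^n$, $v_j\in\mathbb F^n$, is $\operatorname{wt}(v)=\sum_{j=0}^N\operatorname{wt}(v_j)$, where $\operatorname{wt}(v_j)$ is the Hamming weight, and $\operatorname{dist}(\mathcal C)=\min\{\operatorname{wt}(v)\mid v\in\mathcal C,\ v\neq0\}$. Proposition. Let $k>1$ and let $\mathcal C\subseteq\mathbb F[z]^n$ be a convolutional code with parameters $(n,k,km)_q$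 and memory $m$, where $m\le\frac nk-1$. Then $$\operatorname{dist}(\mathcal C)\le(m+1)(n-k+1)+(k-2)m.$$ -/

import Mathlib

open Polynomial

namespace ConvCode

variable {F : Type*} [Field F] {k n : ℕ}

/-- The degree of a polynomial vector: the maximum degree of its components
(with the value `0` for the zero vector). -/
def vecDegree (v : Fin n → F[X]) : ℕ :=
  Finset.univ.sup fun i => (v i).natDegree

/-- The `k`-minor of `G ∈ F[z]^{k × n}` on the columns selected by `s`. -/
noncomputable def minor (G : Matrix (Fin k) (Fin n) F[X]) (s : Fin k ↪o Fin n) : F[X] :=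
  (G.submatrix id s).det

open scoped Classical in
/-- The maximum degree of the `k`-minors of `G`. -/
noncomputable def minorDegree (G : Matrix (Fin k) (Fin n) F[X]) : ℕ :=
  Finset.univ.sup fun s : Fin k ↪o Fin n => (minor G s).natDegree

/-- The submodule `im G = {u G | u ∈ F[z]^k}` of `F[z]^n`. -/
noncomputable def im (G : Matrix (Fin k) (Fin n) F[X]) : Submodule F[X] (Fin n → F[X]) :=
  LinearMap.range G.vecMulLinear

/-- `C ⊆ F[z]^n` is a convolutional code with parameters `(n, k, δ)`. -/
def IsConvolutionalCode (C : Submodule F[X] (Fin n → F[X])) (k δ : ℕ) : Prop :=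
  ∃ G : Matrix (Fin k) (Fin n) F[X],
    (∃ H : Matrix (Fin n) (Fin k) F[X], G * H = 1) ∧ C = im G ∧ δ = minorDegree G

/-- `G ∈ F[z]^{k × n}` is minimal: it has rank `k`, and the maximum degree of its `k`-minors is
the sum of its row degrees. -/
def IsMinimal (G : Matrix (Fin k) (Fin n) F[X]) : Prop :=
  LinearIndependent F[X] G.row ∧ minorDegree G = ∑ i, vecDegree (G i)

/-- The submodule `S` has memory `m`: the largest row degree of a minimal generator matrix of `S`
is `m`. (The row degrees of a minimal generator matrix are determined by `S` up to order.) -/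
def HasMemory (S : Submodule F[X] (Fin n → F[X])) (m : ℕ) : Prop :=
  ∃ (k : ℕ) (G : Matrix (Fin k) (Fin n) F[X]),
    IsMinimal G ∧ S = im G ∧ m = Finset.univ.sup fun i => vecDegree (G i)

/-- The weight of `v = ∑ v_j z^j`: the sum of the Hamming weights of the coefficients
`v_j ∈ F^n`. -/
def wt [DecidableEq F] (v : Fin n → F[X]) : ℕ :=
  ∑ j ∈ Finset.range (vecDegree v + 1), hammingNorm fun i => (v i).coeff j

/-- The free distance: the minimum weight of a nonzero element of `C`. -/
noncomputable def dist [DecidableEq F] (C : Submodule F[X] (Fin n → F[X])) : ℕ :=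
  sInf {w | ∃ v ∈ C, v ≠ 0 ∧ wt v = w}

end ConvCode

/-!
The words of degree at most `m` of a convolutional code of memory `m` form, when they are read as
tuples of coefficients, a linear block code of length `N = (m + 1) n` and dimension at least `k`.
Its minimum distance `d` is at least the free distance, and it satisfies the first two terms of the
Griesmer bound: shortening at `k - 2` coordinates leaves dimension at least two, and averaging the
Hamming weight over the shortened code gives `d + ⌈d / q⌉ ≤ N - (k - 2)`. If `d > q m`, then
`⌈d / q⌉ ≥ m + 1`, which is the claim; the conditions on the parameters place the claimed bound
above `q m`.
-/

namespace ConvCode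

open Finset Module
open scoped Matrix

section BlockCode

variable {K V W ι : Type*} [Field K] [AddCommGroup V] [Module K V] [AddCommGroup W] [Module K W]

theorem finrank_le_finrank_inf_ker_add [FiniteDimensional K W] (U : Submodule K V)
    [FiniteDimensional K U] (f : V →ₗ[K] W) :
    finrank K U ≤ finrank K (U ⊓ LinearMap.ker f : Submodule K V) + finrank K W := by
  have hker : finrank K (LinearMap.ker (f.domRestrict U)) =
      finrank K (U ⊓ LinearMap.ker f : Submodule K V) := by
    rw [← Submodule.finrank_map_subtype_eq, LinearMap.ker_domRestrict, Submodule.map_comap_subtype]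
  rw [← (f.domRestrict U).finrank_range_add_finrank_ker, hker, add_comm]
  exact Nat.add_le_add_left (Submodule.finrank_le _) _

theorem card_mul_card_apply_ne_zero_le [Fintype K] [DecidableEq K] [Fintype V] (f : V →ₗ[K] K) :
    Fintype.card K * #{x | f x ≠ 0} ≤ (Fintype.card K - 1) * Fintype.card V := by
  classical
  have hV : Fintype.card V ≤ Fintype.card K * #{x | f x = 0} := by
    have hcard : Fintype.card (LinearMap.ker f) = #{x | f x = 0} :=
      Fintype.card_of_subtype _ (by simp)
    have hrank : finrank K V ≤ finrank K (LinearMap.ker f) + 1 := by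
      rw [← f.finrank_range_add_finrank_ker, add_comm]
      exact Nat.add_le_add_left ((Submodule.finrank_le _).trans (finrank_self K).le) _
    rw [← hcard, card_eq_pow_finrank (K := K) (V := LinearMap.ker f),
      card_eq_pow_finrank (K := K) (V := V), ← pow_succ']
    exact Nat.pow_le_pow_right Fintype.card_pos hrank
  have hsplit : #{x | f x = 0} + #{x | f x ≠ 0} = Fintype.card V :=
    card_filter_add_card_filter_not _
  rw [Nat.sub_mul, ← hsplit, mul_add]
  omega

variable [Fintype K] [DecidableEq K] [Fintype ι]

theorem plotkin_bound {U : Submodule K (ι → K)} {T : Finset ι} {d : ℕ}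
    (hT : ∀ x ∈ U, ∀ i ∉ T, x i = 0) (hd : ∀ x ∈ U, x ≠ 0 → d ≤ hammingNorm x) :
    Fintype.card K * ((Nat.card U - 1) * d) ≤ #T * ((Fintype.card K - 1) * Nat.card U) := by
  classical
  rw [Nat.card_eq_fintype_card]
  have hlower : (Fintype.card U - 1) * d ≤ ∑ x : U, hammingNorm (x : ι → K) :=
    calc (Fintype.card U - 1) * d = #(univ.erase (0 : U)) • d := by
          rw [card_erase_of_mem (mem_univ _), card_univ, smul_eq_mul]
      _ ≤ ∑ x ∈ univ.erase (0 : U), hammingNorm (x : ι → K) :=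
          card_nsmul_le_sum _ _ _ fun x hx => hd x x.2 (by simpa using hx)
      _ ≤ ∑ x : U, hammingNorm (x : ι → K) := sum_le_sum_of_subset (erase_subset _ _)
  have hnorm (x : U) : hammingNorm (x : ι → K) = #{i ∈ T | (x : ι → K) i ≠ 0} := by
    rw [hammingNorm]
    congr 1
    ext i
    have := hT x x.2 i
    simp only [mem_filter, mem_univ, true_and]
    tauto
  have hcount : ∑ x : U, hammingNorm (x : ι → K) = ∑ i ∈ T, #{x : U | (x : ι → K) i ≠ 0} := by
    simp only [hnorm]
    exact sum_card_bipartiteAbove_eq_sum_card_bipartiteBelow _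
  calc Fintype.card K * ((Fintype.card U - 1) * d)
      ≤ ∑ i ∈ T, Fintype.card K * #{x : U | (x : ι → K) i ≠ 0} := by
        rw [← mul_sum, ← hcount]
        exact Nat.mul_le_mul_left _ hlower
    _ ≤ #T * ((Fintype.card K - 1) * Fintype.card U) :=
        sum_le_card_nsmul _ _ _ fun i _ =>
          card_mul_card_apply_ne_zero_le (LinearMap.proj i ∘ₗ U.subtype)

theorem add_ceilDiv_card_le_card {U : Submodule K (ι → K)} {T : Finset ι} {d : ℕ}
    (hU : 2 ≤ finrank K U) (hT : ∀ x ∈ U, ∀ i ∉ T, x i = 0)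
    (hd : ∀ x ∈ U, x ≠ 0 → d ≤ hammingNorm x) :
    d + d ⌈/⌉ Fintype.card K ≤ #T := by
  have hplotkin := plotkin_bound hT hd
  have hq : 1 < Fintype.card K := Fintype.one_lt_card
  have hcard : Fintype.card K ^ 2 ≤ Nat.card U := by
    rw [natCard_eq_pow_finrank (K := K), Nat.card_eq_fintype_card]
    exact Nat.pow_le_pow_right Fintype.card_pos hU
  generalize Fintype.card K = q at *
  generalize Nat.card U = u at *
  obtain ⟨s, rfl⟩ := Nat.exists_eq_add_of_le' hq.le
  obtain ⟨w, rfl⟩ := Nat.exists_eq_add_of_le' ((Nat.one_le_pow 2 _ s.succ_pos).trans hcard)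
  simp only [Nat.add_sub_cancel] at hplotkin
  have hfactor : s * (s + 2) * (w + 1) ≤ (s + 1) ^ 2 * w := by linarith
  have hmul : (s * (w + 1)) * ((s + 2) * d) ≤ (s * (w + 1)) * ((s + 1) * #T) :=
    calc (s * (w + 1)) * ((s + 2) * d) = (s * (s + 2) * (w + 1)) * d := by ring
      _ ≤ ((s + 1) ^ 2 * w) * d := Nat.mul_le_mul_right _ hfactor
      _ = (s + 1) * ((s + 1) * (w * d)) := by ring
      _ ≤ (s + 1) * (#T * (s * (w + 1))) := Nat.mul_le_mul_left _ hplotkin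
      _ = (s * (w + 1)) * ((s + 1) * #T) := by ring
  have hle : (s + 2) * d ≤ (s + 1) * #T :=
    Nat.le_of_mul_le_mul_left hmul (Nat.mul_pos (by omega) w.succ_pos)
  have hdT : d ≤ #T := by nlinarith
  have hceil : d ⌈/⌉ (s + 1) ≤ #T - d := by
    rw [ceilDiv_le_iff_le_mul s.succ_pos]
    zify [hdT] at hle ⊢
    linarith
  omega

/-- The first two terms of the Griesmer bound `∑ i < k, ⌈d / q ^ i⌉ ≤ N`, the others being replaced
by `1`. -/
theorem add_ceilDiv_card_add_finrank_le {U : Submodule K (ι → K)} {d : ℕ} (hU : 2 ≤ finrank K U)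
    (hd : ∀ x ∈ U, x ≠ 0 → d ≤ hammingNorm x) :
    d + d ⌈/⌉ Fintype.card K + finrank K U ≤ Fintype.card ι + 2 := by
  classical
  have hUι : finrank K U ≤ Fintype.card ι := by simpa using U.finrank_le
  obtain ⟨S, -, hS⟩ := exists_subset_card_eq (s := (univ : Finset ι)) (n := finrank K U - 2)
    (by rw [card_univ]; omega)
  let restrict : (ι → K) →ₗ[K] S → K := LinearMap.funLeft K K Subtype.val
  have hrank : 2 ≤ finrank K (U ⊓ LinearMap.ker restrict : Submodule K (ι → K)) := by
    have := finrank_le_finrank_inf_ker_add U restrict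
    rw [finrank_fintype_fun_eq_card, Fintype.card_coe, hS] at this
    omega
  have hshort : d + d ⌈/⌉ Fintype.card K ≤ #Sᶜ := by
    refine add_ceilDiv_card_le_card hrank (fun x hx i hi => ?_) fun x hx => hd x hx.1
    exact congrFun (LinearMap.mem_ker.1 hx.2) ⟨i, by simpa using hi⟩
  rw [card_compl, hS] at hshort
  omega

end BlockCode

section FreeDistance

variable {F : Type*} [Field F] {k n m : ℕ}

/-- The coefficients of `z ^ 0, …, z ^ m` of a polynomial vector, as one word of length
`(m + 1) n`. -/
noncomputable def coeffWord (m n : ℕ) : (Fin n → F[X]) →ₗ[F] Fin (m + 1) × Fin n → F :=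
  LinearMap.pi fun c => lcoeff F c.1 ∘ₗ LinearMap.proj c.2

/-- The linear block code of length `(m + 1) n` formed by the codewords of degree at most `m`. -/
noncomputable def blockCode (S : Submodule F[X] (Fin n → F[X])) (m : ℕ) :
    Submodule F (Fin (m + 1) × Fin n → F) :=
  (S.restrictScalars F ⊓ Submodule.pi Set.univ fun _ => degreeLE F m).map (coeffWord m n)

theorem vecDegree_le_iff {v : Fin n → F[X]} : vecDegree v ≤ m ↔ ∀ i, (v i).natDegree ≤ m := by
  simp [vecDegree]

theorem mem_pi_degreeLE_iff {v : Fin n → F[X]} :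
    v ∈ Submodule.pi Set.univ (fun _ => degreeLE F m) ↔ vecDegree v ≤ m := by
  simp [vecDegree_le_iff, mem_degreeLE, natDegree_le_iff_degree_le]

theorem eq_zero_of_coeffWord_eq_zero {v : Fin n → F[X]} (hv : vecDegree v ≤ m)
    (h : coeffWord m n v = 0) : v = 0 := by
  ext i j
  rcases le_or_gt j m with hj | hj
  · exact congrFun h (⟨j, Nat.lt_succ_of_le hj⟩, i)
  · exact coeff_eq_zero_of_natDegree_lt ((vecDegree_le_iff.1 hv i).trans_lt hj)

theorem wt_le_hammingNorm_coeffWord [DecidableEq F] {v : Fin n → F[X]} (hv : vecDegree v ≤ m) :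
    wt v ≤ hammingNorm (coeffWord m n v) :=
  calc wt v ≤ ∑ j ∈ range (m + 1), hammingNorm fun i => (v i).coeff j :=
        sum_le_sum_of_subset (range_mono (Nat.succ_le_succ hv))
    _ = hammingNorm (coeffWord m n v) := by
        rw [sum_range]
        simp only [hammingNorm, card_filter, Fintype.sum_prod_type]
        rfl

theorem dist_le_wt [DecidableEq F] {S : Submodule F[X] (Fin n → F[X])} {v : Fin n → F[X]}
    (hv : v ∈ S) (h0 : v ≠ 0) : dist S ≤ wt v :=
  Nat.sInf_le ⟨v, hv, h0, rfl⟩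

theorem dist_le_hammingNorm_of_mem_blockCode [DecidableEq F] {S : Submodule F[X] (Fin n → F[X])}
    {x : Fin (m + 1) × Fin n → F} (hx : x ∈ blockCode S m) (h0 : x ≠ 0) :
    dist S ≤ hammingNorm x := by
  obtain ⟨v, ⟨hvS, hv⟩, rfl⟩ := hx
  exact (dist_le_wt hvS (ne_zero_of_map h0)).trans
    (wt_le_hammingNorm_coeffWord (mem_pi_degreeLE_iff.1 hv))

theorem card_le_finrank_blockCode {ι : Type*} [Fintype ι] {S : Submodule F[X] (Fin n → F[X])}
    {w : ι → Fin n → F[X]} (hw : LinearIndependent F w) (hwS : ∀ i, w i ∈ S)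
    (hdeg : ∀ i, vecDegree (w i) ≤ m) : Fintype.card ι ≤ finrank F (blockCode S m) := by
  have hspan : Submodule.span F (Set.range w) ≤
      S.restrictScalars F ⊓ Submodule.pi Set.univ fun _ => degreeLE F m :=
    Submodule.span_le.2 <| Set.range_subset_iff.2 fun i =>
      ⟨hwS i, mem_pi_degreeLE_iff.2 (hdeg i)⟩
  have hinj : Disjoint (Submodule.span F (Set.range w)) (LinearMap.ker (coeffWord m n)) :=
    LinearMap.disjoint_ker.2 fun v hv =>
      eq_zero_of_coeffWord_eq_zero (mem_pi_degreeLE_iff.1 (hspan hv).2)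
  rw [← finrank_span_eq_card (hw.map hinj), Set.range_comp, Submodule.span_image]
  exact Submodule.finrank_mono (Submodule.map_mono hspan)

theorem finrank_im {G : Matrix (Fin k) (Fin n) F[X]} (hG : LinearIndependent F[X] G.row) :
    finrank F[X] (im G) = k :=
  (LinearMap.finrank_range_of_inj (f := G.vecMulLinear)
    (Matrix.vecMul_injective_iff.2 hG)).trans (finrank_fin_fun F[X])

theorem row_mem_im (G : Matrix (Fin k) (Fin n) F[X]) (i : Fin k) : G.row i ∈ im G :=
  ⟨Pi.single i 1, Matrix.single_one_vecMul i G⟩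

theorem IsConvolutionalCode.finrank_eq {S : Submodule F[X] (Fin n → F[X])} {δ : ℕ}
    (hS : IsConvolutionalCode S k δ) : finrank F[X] S = k := by
  obtain ⟨G, ⟨H, hGH⟩, rfl, -⟩ := hS
  have hleft : Function.LeftInverse (· ᵥ* H) (· ᵥ* G) := fun u =>
    (Matrix.vecMul_vecMul u G H).trans (by rw [hGH, Matrix.vecMul_one])
  exact finrank_im (Matrix.vecMul_injective_iff.1 hleft.injective)

theorem HasMemory.exists_linearIndependent {S : Submodule F[X] (Fin n → F[X])}
    (hS : HasMemory S m) : ∃ w : Fin (finrank F[X] S) → Fin n → F[X],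
      LinearIndependent F w ∧ (∀ i, w i ∈ S) ∧ ∀ i, vecDegree (w i) ≤ m := by
  obtain ⟨k, G, ⟨hG, -⟩, rfl, rfl⟩ := hS
  rw [finrank_im hG]
  exact ⟨G.row, LinearIndependent.restrict_scalars' F hG, row_mem_im G, fun i =>
    le_sup (f := fun i => vecDegree (G i)) (mem_univ i)⟩

theorem card_mul_memory_le {q : ℕ} (hq : q ≤ n + 1) (hk : 1 < k)
    (hm : (m : ℚ) ≤ (n : ℚ) / (k : ℚ) - 1) :
    (q : ℤ) * m ≤ ((m : ℤ) + 1) * ((n : ℤ) - k + 1) + ((k : ℤ) - 2) * m := by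
  have hlen : (m + 1) * k ≤ n := by
    have hk0 : (0 : ℚ) < k := by exact_mod_cast hk.pos
    exact_mod_cast (le_div_iff₀ hk0).1 (le_sub_iff_add_le.1 hm)
  have hmn : 2 * m + k ≤ n := by nlinarith
  have hqm : q * m ≤ (n + 1) * m := Nat.mul_le_mul_right m hq
  zify at hmn hqm
  linarith

end FreeDistance

end ConvCode

theorem proposition4p1_general {F : Type*} [Field F] [Fintype F] [DecidableEq F] {n k m : ℕ}
    {C : Submodule F[X] (Fin n → F[X])} {w : Fin k → Fin n → F[X]} (hw : LinearIndependent F w)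
    (hwC : ∀ i, w i ∈ C) (hdeg : ∀ i, ConvCode.vecDegree (w i) ≤ m) (hk : 1 < k) :
    (ConvCode.dist C : ℤ) ≤ max ((Fintype.card F : ℤ) * m)
      (((m : ℤ) + 1) * ((n : ℤ) - k + 1) + ((k : ℤ) - 2) * m) := by
  rw [le_max_iff, or_iff_not_imp_left, not_le]
  intro hlarge
  have hdim : k ≤ Module.finrank F (ConvCode.blockCode C m) := by
    simpa using ConvCode.card_le_finrank_blockCode hw hwC hdeg
  have hgriesmer := ConvCode.add_ceilDiv_card_add_finrank_le (hk.trans_le hdim) fun _ =>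
    ConvCode.dist_le_hammingNorm_of_mem_blockCode
  have hceil : m < ConvCode.dist C ⌈/⌉ Fintype.card F := by
    rw [← not_le, ceilDiv_le_iff_le_mul Fintype.card_pos, not_le]
    exact_mod_cast hlarge
  rw [Fintype.card_prod, Fintype.card_fin, Fintype.card_fin] at hgriesmer
  have hbound : ConvCode.dist C + m + k ≤ (m + 1) * n + 1 := by omega
  zify at hbound
  linarith

theorem proposition4p1 {F : Type*} [Field F] [Fintype F] [DecidableEq F] (q n k m : ℕ)
    (hq : Fintype.card F = q) (hn : n = q - 1) (hk : 1 < k)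
    (C : Submodule (Polynomial F) (Fin n → Polynomial F))
    (hC : ConvCode.IsConvolutionalCode C k (k * m)) (hmem : ConvCode.HasMemory C m)
    (hm : (m : ℚ) ≤ (n : ℚ) / (k : ℚ) - 1) :
    (ConvCode.dist C : ℤ) ≤ ((m : ℤ) + 1) * ((n : ℤ) - k + 1) + ((k : ℤ) - 2) * m := by
  obtain ⟨w, hw, hwC, hdeg⟩ := hC.finrank_eq ▸ hmem.exists_linearIndependent
  exact (proposition4p1_general hw hwC hdeg hk).trans
    (max_le (ConvCode.card_mul_memory_le (by omega) hk hm) le_rfl)
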